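/- **Theorem 1 (User scaling law: antenna selection-based OIA).** Consider a $K$-cell MIMO interfering multiple-access channel. Each cell has one base station (BS) with $M$ antennas and $N$ users with $L\ge 1$ antennas each, and $1\le S\le M$, $S\le N$; here $K,M,S$ are fixed, while $N=N(\mathrm{SNR})$ and $L=L(\mathrm{SNR})$ may depend on the SNR (constant $L$ is allowed). The channel from user $j$ of cell $i$ to BS $k$ is $\mathbf H_k^{[i,j]}\in\mathbb C^{M\times L}$ with columns $\mathbf h_{k,1}^{[i,j]},\dots,\mathbf h_{k,L}^{[i,j]}$; all channel coefficients are i.i.d. circularly symmetric complex Gaussian with a fixed nonzero variance. BS $k$ has a full-rank (almost surely) matrix $\mathbf Q_k\in\mathbb C^{M\times(M-S)}$ and a matrix $\mathbf U_k\in\mathbb C^{M\times S}$ whose columns form an orthonormal basis of the null space of $\mathbf Q_k^H$; these are deterministic or random (for instance isotropic), and independent of the channels. User $j$ of cell $i$ transmits with weight vector $\mathbf w^{[i,j]}=\mathbf e_{\hat l(i,j)}$, the $\hat l(i,j)$-th column of the $L\times L$ identity matrix, where $$\hat l(i,j)\in\arg\min_{1\le l\le L}\sum_{k\ne i}\big\|\mathbf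 U_k^H\mathbf h_{k,l}^{[i,j]}\big\|^2,\qquad \eta^{[i,j]}=\sum_{k\ne i}\big\|\mathbf U_k^H\mathbf h_{k,\hat l(i,j)}^{[i,j]}\big\|^2 ,$$ and in each cell $S$ users with the smallest metrics $\eta^{[i,j]}$ are selected (ties and order being resolved by any measurable rule depending on the compared metrics); relabel them $1,\dots,S$. BS $i$ uses the zero-forcing equalizer $$\mathbf F_i=[\mathbf f_{i,1},\dots,\mathbf f_{i,S}]=\Big(\big[\mathbf U_i^H\mathbf H_i^{[i,1]}\mathbf w^{[i,1]},\dots,\mathbf U_i^H\mathbf H_i^{[i,S]}\mathbf w^{[i,S]}\big]^{-1}\Big)^H,$$ so that the $j$-th selected user of cell $i$ has rate $$R^{[i,j]}=\log\Big(1+\frac{\mathrm{SNR}}{\|\mathbf f_{i,j}\|^2+I_{i,j}}\Big),\qquad I_{i,j}=\sum_{k\ne i}\sum_{m=1}^{S}\big|\mathbf f_{i,j}^H\mathbf U_i^H\mathbf H_i^{[k,m]}\mathbf w^{[k,m]}\big|^2\,\mathrm{SNR}.$$ If $N=\omega\big(L^{-1}\mathrm{SNR}^{(K-1)S}\big)$,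 that is, $L^{-1}\mathrm{SNR}^{(K-1)S}/N\to 0$ as $\mathrm{SNR}\to\infty$, then the scheme achieves $\mathrm{DoF}\ge KS$ with high probability: for every $\delta>0$, $$\lim_{\mathrm{SNR}\to\infty}\Pr\Big\{\frac{\sum_{i=1}^{K}\sum_{j=1}^{S}R^{[i,j]}}{\log \mathrm{SNR}}\ge KS-\delta\Big\}=1 .$$ Moreover, for every $\epsilon>0$, the probability that every cell has at least $S$ users with $\eta^{[i,j]}\le \epsilon\,\mathrm{SNR}^{-1}/(KS^2)$ tends to $1$ as $\mathrm{SNR}\to\infty$. -/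

import Mathlib

open Filter Topology MeasureTheory ProbabilityTheory Matrix
open scoped NNReal ENNReal

noncomputable section

namespace OIA

/-- Entrywise (product) sigma-algebra on complex matrices. -/
instance instMeasurableSpaceMatrix {m n : Type*} : MeasurableSpace (Matrix m n ℂ) :=
  inferInstanceAs (MeasurableSpace (m → n → ℂ))

/-- Squared Euclidean norm of a complex vector. -/
def sqNorm {n : ℕ} (x : Fin n → ℂ) : ℝ := ∑ s, ‖x s‖ ^ 2

/-- Circularly symmetric complex Gaussian law: real and imaginary parts are independent,
centred real Gaussians of variance `v` each. -/
def complexGaussian (v : ℝ≥0) : Measure ℂ :=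
  ((gaussianReal 0 v).prod (gaussianReal 0 v)).map (fun p => (⟨p.1, p.2⟩ : ℂ))

/-- All channel matrices of the network: `H k i j` is the `M × L` matrix of the channel from
user `j` of cell `i` to base station `k`. -/
abbrev Channels (K M N L : ℕ) := Fin K → Fin K → Fin N → Matrix (Fin M) (Fin L) ℂ

/-- All channel coefficients are independent and identically distributed complex Gaussians. -/
structure IsGaussianChannel {Ω : Type*} [MeasurableSpace Ω] (P : Measure Ω)
    {K M N L : ℕ} (v : ℝ≥0) (H : Ω → Channels K M N L) : Prop where
  measurable : ∀ k i j m l, Measurable fun ω => H ω k i j m l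
  law : ∀ k i j m l, P.map (fun ω => H ω k i j m l) = complexGaussian v
  indep : iIndepFun
    (fun (q : Fin K × Fin K × Fin N × Fin M × Fin L) ω =>
      H ω q.1 q.2.1 q.2.2.1 q.2.2.2.1 q.2.2.2.2) P

/-- `Q` is a full-rank basis of an interference space of dimension `M - S`, and the `S` columns
of `U` form an orthonormal basis of the null space of `Qᴴ`, i.e. of the orthogonal complement
of the span of `Q`. -/
structure IsReferenceBasis {M S : ℕ} (Q : Matrix (Fin M) (Fin (M - S)) ℂ)
    (U : Matrix (Fin M) (Fin S) ℂ) : Prop where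
  fullRank : LinearIndependent ℂ Q.col
  orthonormal : Uᴴ * U = 1
  null : Qᴴ * U = 0

section Metrics

variable {K M S N L : ℕ} (U : Fin K → Matrix (Fin M) (Fin S) ℂ) (H : Channels K M N L)

/-- Leakage of interference of antenna `l` of user `j` in cell `i`:
`∑_{k ≠ i} ‖U_kᴴ h_{k,l}^{[i,j]}‖²`. -/
def antennaLIF (i : Fin K) (j : Fin N) (l : Fin L) : ℝ :=
  ∑ k ∈ Finset.univ.erase i, sqNorm ((U k)ᴴ *ᵥ (H k i j).col l)

end Metrics

/-- A (measurable) rule choosing an antenna of minimal metric, with arbitrary tie-breaking. -/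
structure AntennaRule (L : ℕ) where
  sel : (Fin L → ℝ) → Fin L
  measurable_sel : Measurable sel
  sel_le : ∀ (x : Fin L → ℝ) (l : Fin L), x (sel x) ≤ x l

/-- A (measurable) rule choosing `S` distinct users among `N` with the smallest metrics, with
arbitrary order and tie-breaking. -/
structure UserRule (N S : ℕ) where
  sel : (Fin N → ℝ) → Fin S → Fin N
  measurable_sel : Measurable sel
  injective_sel : ∀ x : Fin N → ℝ, Function.Injective (sel x)
  sel_le : ∀ (x : Fin N → ℝ) (s : Fin S) (j : Fin N), j ∉ Set.range (sel x) → x (sel x s) ≤ x j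

section Scheme

variable {K M S N L : ℕ} (A : Fin K → Fin N → AntennaRule L) (B : Fin K → UserRule N S)
  (U : Fin K → Matrix (Fin M) (Fin S) ℂ) (H : Channels K M N L)

/-- The antenna selected by user `j` of cell `i`. -/
def selectedAntenna (i : Fin K) (j : Fin N) : Fin L := (A i j).sel (antennaLIF U H i j)

/-- The scheduling metric of user `j` of cell `i`. -/
def metricAS (i : Fin K) (j : Fin N) : ℝ := antennaLIF U H i j (selectedAntenna A U H i j)

/-- The weight vector of user `j` of cell `i`: a column of the identity matrix. -/
def weightAS (i : Fin K) (j : Fin N) : Fin L → ℂ := Pi.single (selectedAntenna A U H i j) 1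

/-- The user carrying stream `s` of cell `i`. -/
def selectedUser (i : Fin K) (s : Fin S) : Fin N := (B i).sel (metricAS A U H i) s

/-- `U_kᴴ H_k^{[i,j]} w^{[i,j]}`, where `j` is the user carrying stream `s` of cell `i`. -/
def effChannel (k i : Fin K) (s : Fin S) : Fin S → ℂ :=
  (U k)ᴴ *ᵥ (H k i (selectedUser A B U H i s) *ᵥ weightAS A U H i (selectedUser A B U H i s))

/-- The zero-forcing equalizer of base station `i`. -/
def zfEqualizer (i : Fin K) : Matrix (Fin S) (Fin S) ℂ :=
  ((Matrix.of fun r s => effChannel A B U H i i s r)⁻¹)ᴴ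

/-- Interference power (relative to the noise) in stream `s` of cell `i`. -/
def interference (snr : ℝ) (i : Fin K) (s : Fin S) : ℝ :=
  ∑ k ∈ Finset.univ.erase i, ∑ m : Fin S,
    ‖star ((zfEqualizer A B U H i).col s) ⬝ᵥ effChannel A B U H i k m‖ ^ 2 * snr

/-- Rate of stream `s` of cell `i`: `log (1 + SNR / (‖f_{i,s}‖² + I_{i,s}))`. -/
def rate (snr : ℝ) (i : Fin K) (s : Fin S) : ℝ :=
  Real.log (1 + snr /
    (sqNorm ((zfEqualizer A B U H i).col s) + interference A B U H snr i s))

/-- Sum-rate of the antenna selection-based scheme. -/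
def sumRate (snr : ℝ) : ℝ := ∑ i : Fin K, ∑ s : Fin S, rate A B U H snr i s

end Scheme

/-- `DoF ≥ d` with high probability, for a random sum-rate `R ρ` at signal-to-noise ratio `ρ`:
for every `δ > 0`, the probability that `R ρ / log ρ ≥ d - δ` tends to one as `ρ → ∞`. -/
def DoFAtLeastWHP {Ω : ℝ → Type*} [∀ ρ, MeasurableSpace (Ω ρ)] (P : ∀ ρ, Measure (Ω ρ))
    (R : ∀ ρ, Ω ρ → ℝ) (d : ℝ) : Prop :=
  ∀ δ : ℝ, 0 < δ →
    Tendsto (fun ρ => P ρ {ω | d - δ ≤ R ρ ω / Real.log ρ}) atTop (𝓝 1)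

end OIA

end

/-! The scheme sees the channels only through the products `U_kᴴ H_k`. Given the bases, these are
again white Gaussian, because a matrix with orthonormal rows preserves that law
(`map_mulVec_pi_complexGaussian`). So everything reduces to `U = 1` with `S` receive antennas.

Two events then suffice. First, every cell has `S` users of leakage `O(1/SNR)`. An antenna is good
when its `(K-1)S` cross coefficients all have squared modulus `O(1/SNR)`, which has probability at
least of order `SNR^{-(K-1)S}`. With about `N L / S` independent trials per block of users, the
scaling hypothesis sends the failure probability to zero (`measure_block_fails`,
`tendsto_scheduling_failure`).

Second, the zero-forcing equalizers are bounded. Selection in cell `i` depends only on channels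
towards other base stations, so it is independent of the direct channels. The selected direct matrix
is thus a white Gaussian matrix, almost surely invertible, and its equalizer norms are tight
uniformly in the SNR (`measure_directChannel_mem_le`, `tendsto_measure_illConditioned`).

On both events noise and interference are `O(1)`, so each stream has rate `log SNR - O(1)`
(`mul_log_le_sumRate`). -/

namespace OIA

/-! ### Complex Gaussian vectors: unitary invariance and small balls -/

section GaussianLaw

lemma measurable_mkComplex : Measurable (fun p : ℝ × ℝ => (⟨p.1, p.2⟩ : ℂ)) :=
  Complex.measurableEquivRealProd.symm.measurable

instance (v : ℝ≥0) : IsProbabilityMeasure (complexGaussian v) :=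
  Measure.isProbabilityMeasure_map measurable_mkComplex.aemeasurable

lemma complexGaussian_singleton {v : ℝ≥0} (hv : v ≠ 0) (z : ℂ) :
    complexGaussian v {z} = 0 := by
  have := nullSingletonClass_gaussianReal (μ := 0) hv
  rw [complexGaussian, Measure.map_apply measurable_mkComplex (measurableSet_singleton z)]
  refine measure_mono_null (t := {z.re} ×ˢ Set.univ) ?_ ?_
  · rintro p hp
    have : (⟨p.1, p.2⟩ : ℂ) = z := hp
    simp [← this]
  · rw [Measure.prod_prod]; simp

/-- The real and imaginary factors multiply to a function of `‖t‖` alone, which is the source of the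
invariance below. -/
lemma charFun_complexGaussian (v : ℝ≥0) (t : ℂ) :
    charFun (complexGaussian v) t = Complex.exp (-((v * ‖t‖ ^ 2 / 2 : ℝ) : ℂ)) := by
  have h : ∀ p : ℝ × ℝ,
      Complex.exp ((inner ℝ (⟨p.1, p.2⟩ : ℂ) t : ℝ) * Complex.I) =
        Complex.exp (t.re * p.1 * Complex.I) * Complex.exp (t.im * p.2 * Complex.I) := by
    intro p
    rw [← Complex.exp_add]
    congr 1
    simp only [Complex.inner, Complex.mul_re, Complex.conj_re, Complex.conj_im]
    push_cast
    ring
  rw [charFun_apply, complexGaussian,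
    integral_map measurable_mkComplex.aemeasurable (by fun_prop)]
  simp_rw [h]
  rw [integral_prod_mul (fun x : ℝ => Complex.exp (t.re * x * Complex.I))
    (fun x : ℝ => Complex.exp (t.im * x * Complex.I)), ← charFun_apply_real, ← charFun_apply_real,
    charFun_gaussianReal, charFun_gaussianReal, ← Complex.exp_add]
  congr 1
  rw [← Complex.normSq_eq_norm_sq, Complex.normSq_apply]
  push_cast
  ring

/-- A matrix with orthonormal rows preserves the law of white complex Gaussian vectors. -/
lemma map_mulVec_pi_complexGaussian {α β : Type*} [Fintype α] [Fintype β] [DecidableEq β]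
    (v : ℝ≥0) (W : Matrix β α ℂ) (hW : W * Wᴴ = 1) :
    (Measure.pi fun _ : α => complexGaussian v).map (fun x => W *ᵥ x) =
      Measure.pi fun _ : β => complexGaussian v := by
  have hm : Measurable fun x : α → ℂ => W *ᵥ x :=
    (Continuous.matrix_mulVec continuous_const continuous_id).measurable
  have := Measure.isProbabilityMeasure_map
    (μ := Measure.pi fun _ : α => complexGaussian v) hm.aemeasurable
  rw [← charFun_eq_pi_iff]
  intro t
  -- The characteristic function of `W x` at `t` is that of `x` at `Wᴴ t`, and `‖Wᴴ t‖ = ‖t‖`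
  -- because `W Wᴴ = 1`; `W` need not be square.
  have key : charFun ((Measure.pi fun _ : α => complexGaussian v).map (WithLp.toLp 2))
      (WithLp.toLp 2 (Wᴴ *ᵥ t.ofLp)) = ∏ a, charFun (complexGaussian v) ((Wᴴ *ᵥ t.ofLp) a) :=
    charFun_pi _
  have hinner : ∀ x : α → ℂ, (inner ℝ (WithLp.toLp 2 (W *ᵥ x) : PiLp 2 fun _ : β => ℂ) t : ℝ) =
      inner ℝ (WithLp.toLp 2 x : PiLp 2 fun _ : α => ℂ) (WithLp.toLp 2 (Wᴴ *ᵥ t.ofLp)) := by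
    intro x
    have e : star (W *ᵥ x) ⬝ᵥ t.ofLp = star x ⬝ᵥ (Wᴴ *ᵥ t.ofLp) := by
      rw [Matrix.star_mulVec, Matrix.dotProduct_mulVec]
    have e' := congrArg Complex.re e
    simp only [dotProduct, Complex.re_sum, Pi.star_apply] at e'
    rw [PiLp.inner_apply, PiLp.inner_apply]
    simp only [Complex.inner]
    simpa [mul_comm] using e'
  have hnorm : ∑ a, ‖(Wᴴ *ᵥ t.ofLp) a‖ ^ 2 = ∑ b, ‖t.ofLp b‖ ^ 2 := by
    have e : star (Wᴴ *ᵥ t.ofLp) ⬝ᵥ (Wᴴ *ᵥ t.ofLp) = star t.ofLp ⬝ᵥ t.ofLp := by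
      rw [Matrix.star_mulVec, Matrix.conjTranspose_conjTranspose, ← Matrix.dotProduct_mulVec,
        Matrix.mulVec_mulVec, hW, Matrix.one_mulVec]
    have e' := congrArg Complex.re e
    simp only [dotProduct, Complex.re_sum, Pi.star_apply] at e'
    have : ∀ z : ℂ, (star z * z).re = ‖z‖ ^ 2 := by
      intro z
      rw [← Complex.normSq_eq_norm_sq, Complex.normSq_apply]
      simp
    simpa only [this] using e'
  rw [Measure.map_map (by fun_prop) hm, charFun_apply, integral_map (by fun_prop) (by fun_prop)]
  rw [charFun_apply, integral_map (by fun_prop) (by fun_prop)] at key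
  simp only [Function.comp_def]
  simp_rw [hinner, key, charFun_complexGaussian, ← Complex.exp_sum]
  congr 1
  simp only [Finset.sum_neg_distrib, ← Complex.ofReal_sum]
  rw [← Finset.sum_div, ← Finset.mul_sum, hnorm, ← Finset.sum_div, ← Finset.mul_sum]

/-- Small-ball bound for a nondegenerate complex Gaussian. -/
lemma exists_le_complexGaussian_ball {v : ℝ≥0} (hv : v ≠ 0) :
    ∃ c : ℝ, 0 < c ∧ ∀ r : ℝ, 0 ≤ r → r ≤ 1 →
      ENNReal.ofReal (c * r) ≤ complexGaussian v {z | ‖z‖ ^ 2 ≤ r} := by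
  set g := gaussianPDFReal 0 v 1 with hg
  have hgpos : 0 < g := gaussianPDFReal_pos 0 v 1 hv
  have hpdf : ∀ x : ℝ, |x| ≤ 1 → g ≤ gaussianPDFReal 0 v x := by
    intro x hx
    rw [hg, gaussianPDFReal, gaussianPDFReal]
    have : x ^ 2 ≤ 1 := by rw [← sq_abs]; nlinarith [abs_nonneg x]
    gcongr _ * Real.exp (-?_ / _)
    simpa using this
  have hreal : ∀ a : ℝ, 0 ≤ a → a ≤ 1 →
      ENNReal.ofReal (g * a) ≤ gaussianReal 0 v (Set.Icc 0 a) := by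
    intro a ha ha1
    rw [gaussianReal_apply _ hv]
    calc ENNReal.ofReal (g * a) = ∫⁻ _ in Set.Icc 0 a, ENNReal.ofReal g := by
          rw [setLIntegral_const, Real.volume_Icc, sub_zero, ENNReal.ofReal_mul hgpos.le]
      _ ≤ _ := by
          refine setLIntegral_mono (measurable_gaussianPDF _ _) fun x hx => ?_
          refine ENNReal.ofReal_le_ofReal (hpdf x ?_)
          rw [abs_of_nonneg hx.1]
          exact hx.2.trans ha1
  -- The square `[0, √(r/2)]²` lies in the disc `‖z‖² ≤ r`, and on `[0, 1]` the real density is at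
  -- least its value `g` at `1`: the mass is at least `(g √(r/2))²`.
  refine ⟨g ^ 2 / 2, by positivity, fun r hr hr1 => ?_⟩
  have ha0 : 0 ≤ √(r / 2) := Real.sqrt_nonneg _
  have hsq : √(r / 2) ^ 2 = r / 2 := Real.sq_sqrt (by positivity)
  have ha1 : √(r / 2) ≤ 1 := Real.sqrt_le_one.mpr (by linarith)
  rw [complexGaussian, Measure.map_apply measurable_mkComplex
    (measurableSet_le (by fun_prop) (by fun_prop))]
  calc ENNReal.ofReal (g ^ 2 / 2 * r)
      = ENNReal.ofReal (g * √(r / 2)) * ENNReal.ofReal (g * √(r / 2)) := by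
        rw [← ENNReal.ofReal_mul (by positivity)]
        congr 1
        calc g ^ 2 / 2 * r = g ^ 2 * (r / 2) := by ring
          _ = g * √(r / 2) * (g * √(r / 2)) := by nth_rw 1 [← hsq]; ring
    _ ≤ _ := mul_le_mul' (hreal _ ha0 ha1) (hreal _ ha0 ha1)
    _ = ((gaussianReal 0 v).prod (gaussianReal 0 v))
        (Set.Icc 0 √(r / 2) ×ˢ Set.Icc 0 √(r / 2)) := (Measure.prod_prod _ _).symm
    _ ≤ _ := by
        refine measure_mono ?_
        rintro ⟨x, y⟩ ⟨hx, hy⟩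
        simp only [Set.mem_ofPred_eq, Set.mem_preimage]
        rw [← Complex.normSq_eq_norm_sq, Complex.normSq_apply]
        have h1 : x * x ≤ r / 2 := by rw [← hsq, sq]; exact mul_self_le_mul_self hx.1 hx.2
        have h2 : y * y ≤ r / 2 := by rw [← hsq, sq]; exact mul_self_le_mul_self hy.1 hy.2
        simp only
        linarith

end GaussianLaw

/-! ### Zero sets of polynomials are null; random matrices are invertible -/

section PolynomialZeros

lemma measurableSet_eval_eq_zero {σ : Type*} [Finite σ] (p : MvPolynomial σ ℂ) :
    MeasurableSet {x | MvPolynomial.eval x p = 0} :=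
  (isClosed_singleton.preimage (MvPolynomial.continuous_eval p)).measurableSet

/-- The zero set of a nonzero polynomial is null for a product of atomless measures. -/
lemma pi_eval_eq_zero_fin {μ : Measure ℂ} [IsProbabilityMeasure μ] (hμ : ∀ z, μ {z} = 0) :
    ∀ (n : ℕ) (p : MvPolynomial (Fin n) ℂ), p ≠ 0 →
      (Measure.pi fun _ : Fin n => μ) {x | MvPolynomial.eval x p = 0} = 0 := by
  intro n
  induction n with
  | zero =>
    intro p hp
    convert measure_empty (μ := Measure.pi fun _ : Fin 0 => μ)
    ext x
    simp only [Set.mem_ofPred_eq, Set.mem_empty_iff_false, iff_false]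
    intro h
    apply hp
    rw [MvPolynomial.eq_C_of_isEmpty p] at h ⊢
    simpa using h
  | succ n ih =>
    intro p hp
    have hmp := measurePreserving_piFinSuccAbove (fun _ : Fin (n + 1) => μ) 0
    set q := MvPolynomial.finSuccEquiv ℂ n p with hq
    have hq0 : q ≠ 0 := by simpa [hq] using hp
    set T : Set (ℂ × (Fin n → ℂ)) :=
      {y | MvPolynomial.eval (Fin.cons y.1 y.2 : Fin (n + 1) → ℂ) p = 0} with hT
    have hcons : Measurable fun y : ℂ × (Fin n → ℂ) => (Fin.cons y.1 y.2 : Fin (n + 1) → ℂ) := by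
      refine measurable_pi_lambda _ fun i => ?_
      refine Fin.cases ?_ (fun j => ?_) i
      · simpa using measurable_fst
      · simp only [Fin.cons_succ]; fun_prop
    have hTm : MeasurableSet T := hcons (measurableSet_eval_eq_zero p)
    have hset : {x | MvPolynomial.eval x p = 0} =
        (MeasurableEquiv.piFinSuccAbove (fun _ : Fin (n + 1) => ℂ) 0) ⁻¹' T := by
      ext x
      simp only [hT, Set.mem_ofPred_eq, Set.mem_preimage]
      have : (Fin.cons (MeasurableEquiv.piFinSuccAbove (fun _ : Fin (n + 1) => ℂ) 0 x).1
          (MeasurableEquiv.piFinSuccAbove (fun _ : Fin (n + 1) => ℂ) 0 x).2 :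
          Fin (n + 1) → ℂ) = x := by
        ext i
        refine Fin.cases ?_ (fun j => ?_) i <;> simp [MeasurableEquiv.piFinSuccAbove, Fin.tail]
      rw [this]
    rw [hset, hmp.measure_preimage hTm.nullMeasurableSet, Measure.prod_apply_symm hTm,
      lintegral_eq_zero_iff (measurable_measure_prodMk_right hTm)]
    -- Fubini: for almost every tail `y` the leading coefficient in the first variable is nonzero,
    -- so the slice is a finite root set, null because `μ` has no atoms.
    have hlead : ∀ᵐ y ∂(Measure.pi fun _ : Fin n => μ),
        MvPolynomial.eval y q.leadingCoeff ≠ 0 := by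
      rw [ae_iff]
      simpa using ih q.leadingCoeff (by simpa using hq0)
    filter_upwards [hlead] with y hy
    have hmap : q.map (MvPolynomial.eval y) ≠ 0 := by
      intro h
      apply hy
      rw [Polynomial.leadingCoeff, ← Polynomial.coeff_map, h, Polynomial.coeff_zero]
    refine measure_mono_null (t := (q.map (MvPolynomial.eval y)).rootSet ℂ) ?_ ?_
    · intro z hz
      simp only [hT, Set.mem_preimage, Set.mem_ofPred_eq,
        MvPolynomial.eval_eq_eval_mv_eval'] at hz
      rw [Polynomial.mem_rootSet]
      exact ⟨hmap, by simpa [Polynomial.aeval_def] using hz⟩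
    · have hfin := (Polynomial.rootSet_finite (q.map (MvPolynomial.eval y)) ℂ).countable
      rw [← Set.biUnion_of_singleton ((q.map (MvPolynomial.eval y)).rootSet ℂ)]
      exact (measure_biUnion_null_iff hfin).2 fun z _ => hμ z

lemma pi_eval_eq_zero {σ : Type*} [Fintype σ] {μ : Measure ℂ} [IsProbabilityMeasure μ]
    (hμ : ∀ z, μ {z} = 0) (p : MvPolynomial σ ℂ) (hp : p ≠ 0) :
    (Measure.pi fun _ : σ => μ) {x | MvPolynomial.eval x p = 0} = 0 := by
  let e := Fintype.equivFin σ
  have hmp := measurePreserving_piCongrLeft (fun _ : Fin (Fintype.card σ) => μ) e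
  have hp' : MvPolynomial.rename e p ≠ 0 := by
    rwa [Ne, MvPolynomial.rename_eq_zero_iff_of_injective _ e.injective]
  have h0 := pi_eval_eq_zero_fin hμ _ _ hp'
  rw [← hmp.measure_preimage (measurableSet_eval_eq_zero _).nullMeasurableSet] at h0
  convert h0 using 2
  ext x
  have hx : (MeasurableEquiv.piCongrLeft (fun _ : Fin (Fintype.card σ) => ℂ) e) x ∘ e = x := by
    ext i
    rw [Function.comp_apply, MeasurableEquiv.coe_piCongrLeft, Equiv.piCongrLeft_apply_apply]
  rw [Set.mem_preimage, Set.mem_ofPred_eq, Set.mem_ofPred_eq, MvPolynomial.eval_rename, hx]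

/-- A square matrix with independent atomless entries is almost surely invertible. -/
lemma pi_det_eq_zero {n : ℕ} {μ : Measure ℂ} [IsProbabilityMeasure μ] (hμ : ∀ z, μ {z} = 0) :
    (Measure.pi fun _ : Fin n × Fin n => μ)
      {x | (Matrix.of fun r s => x (r, s)).det = 0} = 0 := by
  convert pi_eval_eq_zero hμ _ (Matrix.det_mvPolynomialX_ne_zero (Fin n) ℂ) using 2
  ext x
  rw [Set.mem_ofPred_eq, Set.mem_ofPred_eq, RingHom.map_det]
  congr! 2
  ext r s
  simp [Matrix.mvPolynomialX]

end PolynomialZeros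

/-! ### Reduction to white channels with identity bases -/

section Reduction

variable {K M S N L : ℕ}

/-- The channel seen after projection by the matrices `U k`. -/
def projectedChannel (U : Fin K → Matrix (Fin M) (Fin S) ℂ) (H : Channels K M N L) :
    Channels K S N L := fun k i j => (U k)ᴴ * H k i j

/-- Leakages, selections and rates involve `U` and `H` only through `U_kᴴ H_k`; this and the next
lemmas trade `(U, H)` for `(1, U_kᴴ H_k)`. -/
lemma antennaLIF_projectedChannel (U : Fin K → Matrix (Fin M) (Fin S) ℂ) (H : Channels K M N L) :
    antennaLIF (fun _ : Fin K => (1 : Matrix (Fin S) (Fin S) ℂ)) (projectedChannel U H) = antennaLIF U H := by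
  ext i j l
  refine Finset.sum_congr rfl fun k _ => ?_
  rw [Matrix.conjTranspose_one, Matrix.one_mulVec]
  rfl

variable (A : Fin K → Fin N → AntennaRule L) (B : Fin K → UserRule N S)

lemma metricAS_projectedChannel (U : Fin K → Matrix (Fin M) (Fin S) ℂ) (H : Channels K M N L) :
    metricAS A (fun _ : Fin K => (1 : Matrix (Fin S) (Fin S) ℂ)) (projectedChannel U H) = metricAS A U H := by
  ext i j
  simp only [metricAS, selectedAntenna, antennaLIF_projectedChannel]

lemma effChannel_projectedChannel (U : Fin K → Matrix (Fin M) (Fin S) ℂ) (H : Channels K M N L) :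
    effChannel A B (fun _ => 1) (projectedChannel U H) = effChannel A B U H := by
  ext k i s : 3
  simp only [effChannel, weightAS, selectedAntenna, selectedUser, metricAS_projectedChannel,
    antennaLIF_projectedChannel, Matrix.conjTranspose_one, Matrix.one_mul, projectedChannel,
    Matrix.mulVec_mulVec]

lemma sumRate_projectedChannel (U : Fin K → Matrix (Fin M) (Fin S) ℂ) (H : Channels K M N L)
    (snr : ℝ) :
    sumRate A B (fun _ => 1) (projectedChannel U H) snr = sumRate A B U H snr := by
  simp only [sumRate, rate, interference, zfEqualizer, effChannel_projectedChannel]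

/-- All channel coefficients as one vector. -/
def coords (H : Channels K M N L) : Fin M × (Fin K × Fin K × Fin N × Fin L) → ℂ :=
  fun p => H p.2.1 p.2.2.1 p.2.2.2.1 p.1 p.2.2.2.2

lemma measurable_channels {Ω : Type*} [MeasurableSpace Ω] {H : Ω → Channels K M N L}
    (h : ∀ k i j m l, Measurable fun ω => H ω k i j m l) : Measurable H :=
  measurable_pi_lambda _ fun k => measurable_pi_lambda _ fun i => measurable_pi_lambda _ fun j =>
    measurable_pi_lambda _ fun m => measurable_pi_lambda _ fun l => h k i j m l

lemma measurable_entry {m n : ℕ} (r : Fin m) (s : Fin n) :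
    Measurable fun G : Matrix (Fin m) (Fin n) ℂ => G r s :=
  (measurable_pi_apply s).comp (measurable_pi_apply (X := fun _ : Fin m => Fin n → ℂ) r)

lemma measurable_channel_entry (k i : Fin K) (j : Fin N) (m : Fin M) (l : Fin L) :
    Measurable fun H : Channels K M N L => H k i j m l :=
  (measurable_entry m l).comp
    ((measurable_pi_apply j).comp ((measurable_pi_apply i).comp (measurable_pi_apply k)))

lemma measurable_coords : Measurable (coords : Channels K M N L → _) :=
  measurable_pi_lambda _ fun _ => measurable_channel_entry _ _ _ _ _

/-- Stating law and independence as one product law lets the projection act as a single linear map.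
-/
lemma isGaussianChannel_iff {Ω : Type*} [MeasurableSpace Ω] {P : Measure Ω}
    [IsProbabilityMeasure P] {v : ℝ≥0} {H : Ω → Channels K M N L} :
    IsGaussianChannel P v H ↔ Measurable H ∧
      P.map (fun ω => coords (H ω)) = Measure.pi fun _ => complexGaussian v := by
  let e : Fin M × (Fin K × Fin K × Fin N × Fin L) ≃ Fin K × Fin K × Fin N × Fin M × Fin L :=
    { toFun := fun p => (p.2.1, p.2.2.1, p.2.2.2.1, p.1, p.2.2.2.2)
      invFun := fun q => (q.2.2.2.1, q.1, q.2.1, q.2.2.1, q.2.2.2.2)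
      left_inv := fun _ => rfl
      right_inv := fun _ => rfl }
  constructor
  · rintro ⟨hm, hl, hi⟩
    refine ⟨measurable_channels hm, ?_⟩
    have := (hi.precomp e.injective).map_fun_eq_pi_map fun p => (hm _ _ _ _ _).aemeasurable
    simp only [hl] at this
    exact this
  · rintro ⟨hm, hl⟩
    have hm' : ∀ k i j m l, Measurable fun ω => H ω k i j m l := fun k i j m l =>
      (measurable_channel_entry k i j m l).comp hm
    have hlaw : ∀ p, P.map (fun ω => coords (H ω) p) = complexGaussian v := by
      intro p
      have := congrArg (fun μ => μ.map (Function.eval p)) hl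
      simp only [(measurePreserving_eval _ p).map_eq] at this
      have hc : Measurable fun ω => coords (H ω) := measurable_coords.comp hm
      rwa [Measure.map_map (measurable_pi_apply p : Measurable (Function.eval p)) hc] at this
    refine ⟨hm', fun k i j m l => hlaw (m, k, i, j, l), ?_⟩
    refine iIndepFun.of_precomp e.surjective ?_
    refine (iIndepFun_iff_map_fun_eq_pi_map fun p => (hm' _ _ _ _ _).aemeasurable).2 ?_
    refine Eq.trans hl ?_
    congr 1
    ext1 p
    exact (hlaw p).symm

/-- The linear map of the coordinates induced by the projections `U k`. -/
def projectionMatrix (N L : ℕ) (U : Fin K → Matrix (Fin M) (Fin S) ℂ) :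
    Matrix (Fin S × (Fin K × Fin K × Fin N × Fin L)) (Fin M × (Fin K × Fin K × Fin N × Fin L)) ℂ :=
  Matrix.blockDiagonal fun q => (U q.1)ᴴ

lemma projectionMatrix_mul_conjTranspose {U : Fin K → Matrix (Fin M) (Fin S) ℂ}
    (hU : ∀ k, (U k)ᴴ * U k = 1) :
    projectionMatrix N L U * (projectionMatrix N L U)ᴴ = 1 := by
  rw [projectionMatrix, Matrix.blockDiagonal_conjTranspose, ← Matrix.blockDiagonal_mul]
  simp only [Matrix.conjTranspose_conjTranspose, hU]
  exact Matrix.blockDiagonal_one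

lemma coords_projectedChannel (U : Fin K → Matrix (Fin M) (Fin S) ℂ) (H : Channels K M N L) :
    coords (projectedChannel U H) = projectionMatrix N L U *ᵥ coords H := by
  ext ⟨s, q⟩
  rw [projectionMatrix, Matrix.mulVec, dotProduct, Fintype.sum_prod_type]
  simp only [coords, projectedChannel, Matrix.mul_apply, Matrix.blockDiagonal_apply, ite_mul,
    zero_mul, Finset.sum_ite_eq, Finset.mem_univ, if_true]

lemma measurable_projectedChannel {Ω : Type*} [MeasurableSpace Ω]
    {U : Ω → Fin K → Matrix (Fin M) (Fin S) ℂ} {H : Ω → Channels K M N L}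
    (hU : Measurable U) (hH : Measurable H) :
    Measurable fun ω => projectedChannel (U ω) (H ω) := by
  refine measurable_channels fun k i j s l => ?_
  simp only [projectedChannel, Matrix.mul_apply, Matrix.conjTranspose_apply]
  refine Finset.measurable_sum _ fun m _ => ?_
  refine Measurable.mul ?_ ((measurable_channel_entry k i j m l).comp hH)
  exact continuous_star.measurable.comp
    ((measurable_entry m s).comp ((measurable_pi_apply k).comp hU))

/-- The projected channel is white Gaussian even if the projections are random. -/
lemma IsGaussianChannel.projectedChannel {Ω : Type*} [MeasurableSpace Ω] {P : Measure Ω}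
    [IsProbabilityMeasure P] {v : ℝ≥0} {H : Ω → Channels K M N L} (hH : IsGaussianChannel P v H)
    {U : Ω → Fin K → Matrix (Fin M) (Fin S) ℂ} (hUm : Measurable U)
    (hU : ∀ᵐ ω ∂P, ∀ k, (U ω k)ᴴ * U ω k = 1) (hind : IndepFun U H P) :
    IsGaussianChannel P v fun ω => OIA.projectedChannel (U ω) (H ω) := by
  obtain ⟨hHm, hlaw⟩ := isGaussianChannel_iff.1 hH
  refine isGaussianChannel_iff.2 ⟨measurable_projectedChannel hUm hHm, ?_⟩
  have hprod := (indepFun_iff_map_prod_eq_prod_map_map hUm.aemeasurable hHm.aemeasurable).1 hind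
  ext D hD
  set Φ : (Fin K → Matrix (Fin M) (Fin S) ℂ) × Channels K M N L → _ :=
    fun p => coords (OIA.projectedChannel p.1 p.2) with hΦ
  have hΦm : Measurable Φ :=
    measurable_coords.comp (measurable_projectedChannel measurable_fst measurable_snd)
  have h1 : P.map (fun ω => coords (OIA.projectedChannel (U ω) (H ω))) =
      ((P.map U).prod (P.map H)).map Φ := by
    rw [← hprod, Measure.map_map hΦm (hUm.prodMk hHm)]
    rfl
  have := Measure.isProbabilityMeasure_map (μ := P) hUm.aemeasurable
  have := Measure.isProbabilityMeasure_map (μ := P) hHm.aemeasurable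
  rw [h1, Measure.map_apply hΦm hD, Measure.prod_apply (hΦm hD),
    lintegral_map (measurable_measure_prodMk_left (hΦm hD)) hUm]
  -- Conditionally on the bases the projected channel has a law that does not depend on them, so
  -- averaging over the bases returns the same law.
  have h2 : ∀ᵐ ω ∂P, (P.map H) (Prod.mk (U ω) ⁻¹' (Φ ⁻¹' D)) =
      (Measure.pi fun _ => complexGaussian v) D := by
    filter_upwards [hU] with ω hω
    have hWm : Measurable fun x => projectionMatrix N L (U ω) *ᵥ x :=
      (Continuous.matrix_mulVec continuous_const continuous_id).measurable
    have h3 : Prod.mk (U ω) ⁻¹' (Φ ⁻¹' D) =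
        coords ⁻¹' ((fun x => projectionMatrix N L (U ω) *ᵥ x) ⁻¹' D) := by
      ext h
      simp only [hΦ, Set.mem_preimage, coords_projectedChannel]
    rw [h3, ← Measure.map_apply measurable_coords (hWm hD),
      Measure.map_map measurable_coords hHm]
    have h4 : P.map (coords ∘ H) = _ := hlaw
    rw [h4, ← Measure.map_apply hWm hD,
      map_mulVec_pi_complexGaussian v _ (projectionMatrix_mul_conjTranspose hω)]
  rw [lintegral_congr_ae h2]
  simp

end Reduction

/-! ### Probability that enough users have small leakage -/

section Scheduling

/-- Used with `a` a (user, antenna) pair, `b` a (foreign base station, receive coordinate) pair and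
`D` a small disc: the pairs `a` are independent trials, each succeeding with probability `q ^
T.card`. -/
lemma measure_biInter_compl_biInter {Ω α β E : Type*} [MeasurableSpace Ω] [MeasurableSpace E]
    {P : Measure Ω} {X : α × β → Ω → E} (h : iIndepFun X P)
    (hX : ∀ p, Measurable (X p)) {D : Set E} (hD : MeasurableSet D) {q : ℝ≥0∞}
    (hq : ∀ p, P (X p ⁻¹' D) = q) (s : Finset α) (T : Finset β) :
    P (⋂ a ∈ s, (⋂ b ∈ T, X (a, b) ⁻¹' D)ᶜ) = (1 - q ^ T.card) ^ s.card := by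
  have := h.isProbabilityMeasure
  have hprod : ∀ s : Finset α, P (⋂ a ∈ s, ⋂ b ∈ T, X (a, b) ⁻¹' D) =
      ∏ _a ∈ s, q ^ T.card := by
    intro s
    have h1 : (⋂ a ∈ s, ⋂ b ∈ T, X (a, b) ⁻¹' D) = ⋂ p ∈ s ×ˢ T, X p ⁻¹' D := by
      ext ω
      simp only [Set.mem_iInter, Finset.mem_product, and_imp, Prod.forall]
      exact ⟨fun h a b ha hb => h a ha b hb, fun h a ha b hb => h a b ha hb⟩
    rw [h1, h.meas_biInter fun p _ => ⟨D, hD, rfl⟩]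
    simp only [hq, Finset.prod_const, Finset.card_product, mul_comm s.card, pow_mul]
  have hsingle : ∀ a, P (⋂ b ∈ T, X (a, b) ⁻¹' D) = q ^ T.card := by
    intro a
    simpa using hprod {a}
  have hmeas : ∀ a, MeasurableSet (⋂ b ∈ T, X (a, b) ⁻¹' D) := fun a =>
    T.measurableSet_biInter fun b _ => hX _ hD
  have hind : iIndepSet (fun a => ⋂ b ∈ T, X (a, b) ⁻¹' D) P := by
    rw [iIndepSet_iff_meas_biInter hmeas]
    intro s
    rw [hprod s]
    exact Finset.prod_congr rfl fun a _ => (hsingle a).symm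
  rw [(iIndepSet_iff_iIndep _ _).1 hind |>.meas_biInter fun a _ =>
    (MeasurableSpace.measurableSet_generateFrom (Set.mem_singleton _)).compl]
  simp only [prob_compl_eq_one_sub (hmeas _), hsingle, Finset.prod_const]

variable {K S N L : ℕ}

lemma antennaLIF_one (G : Channels K S N L) (i : Fin K) (j : Fin N) (l : Fin L) :
    antennaLIF (fun _ : Fin K => (1 : Matrix (Fin S) (Fin S) ℂ)) G i j l =
      ∑ k ∈ Finset.univ.erase i, ∑ s, ‖G k i j s l‖ ^ 2 := by
  refine Finset.sum_congr rfl fun k _ => ?_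
  rw [Matrix.conjTranspose_one, Matrix.one_mulVec]
  rfl

/-- One good antenna is enough, since the selected one minimises the leakage. The bound counts `K`
base stations instead of `K - 1`. -/
lemma metricAS_le_of_entries (A : Fin K → Fin N → AntennaRule L) {G : Channels K S N L} {i : Fin K}
    {j : Fin N} {l : Fin L} {r : ℝ} (hr : 0 ≤ r)
    (h : ∀ k ∈ Finset.univ.erase i, ∀ s, ‖G k i j s l‖ ^ 2 ≤ r) :
    metricAS A (fun _ : Fin K => (1 : Matrix (Fin S) (Fin S) ℂ)) G i j ≤ K * S * r := by
  refine ((A i j).sel_le _ l).trans ?_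
  rw [antennaLIF_one]
  calc _ ≤ ∑ k ∈ Finset.univ.erase i, ∑ _s : Fin S, r :=
        Finset.sum_le_sum fun k hk => Finset.sum_le_sum fun s _ => h k hk s
    _ ≤ ∑ _k : Fin K, ∑ _s : Fin S, r :=
        Finset.sum_le_sum_of_subset_of_nonneg (Finset.subset_univ _) fun _ _ _ =>
          Finset.sum_nonneg fun _ _ => hr
    _ = K * S * r := by simp [mul_assoc]

/-- If all users of `J` are bad then all their antennas are, which makes `J.card * L` independent
failures. This is how `L` enters the scaling law as a multiplier of `N`. -/
lemma measure_block_fails {Ω : Type*} [MeasurableSpace Ω] {P : Measure Ω} {v : ℝ≥0}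
    {G : Ω → Channels K S N L} (hG : IsGaussianChannel P v G)
    (A : Fin K → Fin N → AntennaRule L) (i : Fin K) {r t : ℝ} (hr : 0 ≤ r) (ht : K * S * r ≤ t)
    (J : Finset (Fin N)) :
    P {ω | ∀ j ∈ J, t < metricAS A (fun _ : Fin K => (1 : Matrix (Fin S) (Fin S) ℂ)) (G ω) i j} ≤
      (1 - complexGaussian v {z | ‖z‖ ^ 2 ≤ r} ^ ((K - 1) * S)) ^ (J.card * L) := by
  have hinj : Function.Injective fun p : (Fin N × Fin L) × (Fin K × Fin S) =>
      (p.2.1, i, p.1.1, p.2.2, p.1.2) := by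
    rintro ⟨⟨a, b⟩, c, d⟩ ⟨⟨a', b'⟩, c', d'⟩ h
    simp only [Prod.mk.injEq] at h ⊢
    tauto
  have hD : MeasurableSet {z : ℂ | ‖z‖ ^ 2 ≤ r} := measurableSet_le (by fun_prop) (by fun_prop)
  have key := measure_biInter_compl_biInter
    (X := fun p ω => G ω p.2.1 i p.1.1 p.2.2 p.1.2) (hG.indep.precomp hinj)
    (fun p => hG.measurable _ _ _ _ _) hD
    (q := complexGaussian v {z | ‖z‖ ^ 2 ≤ r})
    (fun p => by
      rw [← hG.law p.2.1 i p.1.1 p.2.2 p.1.2, Measure.map_apply (hG.measurable _ _ _ _ _) hD])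
    (J ×ˢ Finset.univ) (Finset.univ.erase i ×ˢ Finset.univ)
  have hc : (Finset.univ.erase i ×ˢ (Finset.univ : Finset (Fin S))).card = (K - 1) * S := by
    simp [Finset.card_product, Finset.card_erase_of_mem]
  have hc' : (J ×ˢ (Finset.univ : Finset (Fin L))).card = J.card * L := by
    simp [Finset.card_product]
  rw [hc, hc'] at key
  rw [← key]
  refine measure_mono fun ω hω => ?_
  simp only [Set.mem_iInter, Set.mem_compl_iff, Finset.mem_product, Finset.mem_univ, and_true]
  rintro ⟨j, l⟩ hj h
  refine absurd ((metricAS_le_of_entries (G := G ω) (l := l) A hr fun k hk s => ?_).trans ht)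
    (not_le.2 (hω j hj))
  exact h (k, s) hk

/-- Few users with a small metric are unlikely. -/
lemma measure_ncard_metricAS_lt {Ω : Type*} [MeasurableSpace Ω] {P : Measure Ω} {v : ℝ≥0}
    {G : Ω → Channels K S N L} (hG : IsGaussianChannel P v G)
    (A : Fin K → Fin N → AntennaRule L) (i : Fin K) {r t : ℝ} (hr : 0 ≤ r) (ht : K * S * r ≤ t) :
    P {ω | ¬ S ≤ {j | metricAS A (fun _ : Fin K => (1 : Matrix (Fin S) (Fin S) ℂ))
        (G ω) i j ≤ t}.ncard} ≤
      S * (1 - complexGaussian v {z | ‖z‖ ^ 2 ≤ r} ^ ((K - 1) * S)) ^ (N / S * L) := by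
  -- Cut the users into `S` disjoint blocks of size `⌊N/S⌋`. A good user in each block gives `S`
  -- good users, so a union bound over blocks replaces a binomial tail.
  let e : Fin S × Fin (N / S) ↪ Fin N :=
    finProdFinEquiv.toEmbedding.trans (Fin.castLEEmb (Nat.mul_div_le N S))
  let J : Fin S → Finset (Fin N) := fun b => Finset.univ.map
    ⟨fun c => e (b, c), fun c c' h => by simpa using e.injective h⟩
  have hJ : ∀ b, (J b).card = N / S := fun b => by simp [J]
  calc _ ≤ P (⋃ b, {ω | ∀ j ∈ J b,
        t < metricAS A (fun _ : Fin K => (1 : Matrix (Fin S) (Fin S) ℂ)) (G ω) i j}) := by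
        refine measure_mono fun ω hω => ?_
        by_contra hcon
        simp only [Set.mem_iUnion, Set.mem_ofPred_eq, not_exists, not_forall, not_lt] at hcon
        choose f hf hft using hcon
        refine hω ?_
        have hinj : Function.Injective f := by
          intro b b' h
          obtain ⟨c, -, hc⟩ := Finset.mem_map.1 (hf b)
          obtain ⟨c', -, hc'⟩ := Finset.mem_map.1 (hf b')
          have := hc.trans (h.trans hc'.symm)
          exact congrArg Prod.fst (e.injective this)
        calc S = (Set.range f).ncard := by
              rw [← Set.image_univ, Set.ncard_image_of_injective _ hinj]; simp
          _ ≤ _ := Set.ncard_le_ncard (by rintro _ ⟨b, rfl⟩; exact hft b) (Set.toFinite _)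
    _ ≤ ∑ b, P {ω | ∀ j ∈ J b,
        t < metricAS A (fun _ : Fin K => (1 : Matrix (Fin S) (Fin S) ℂ)) (G ω) i j} :=
        measure_iUnion_fintype_le _ _
    _ ≤ ∑ _b : Fin S, (1 - complexGaussian v {z | ‖z‖ ^ 2 ≤ r} ^ ((K - 1) * S)) ^ (N / S * L) :=
        Finset.sum_le_sum fun b _ => by
          rw [← hJ b]; exact measure_block_fails hG A i hr ht (J b)
    _ = _ := by simp

end Scheduling

/-! ### Independence of selection and direct channels; tightness of the equalizer -/

section ZeroForcing

variable {K S N L : ℕ}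

/-- The channels towards base stations other than `i`. -/
def crossPart (i : Fin K) (G : Channels K S N L) : Channels K S N L :=
  fun k i' j m l => if k = i then 0 else G k i' j m l

lemma crossPart_apply (i : Fin K) (G : Channels K S N L) (k i' : Fin K) (j : Fin N) (m : Fin S)
    (l : Fin L) : crossPart i G k i' j m l = if k = i then 0 else G k i' j m l := rfl

/-- The leakage of cell `i` sums over `k ≠ i` only, so channels towards base station `i` may be
erased without affecting selection in cell `i`. -/
lemma antennaLIF_crossPart (i : Fin K) (G : Channels K S N L) :
    antennaLIF (fun _ : Fin K => (1 : Matrix (Fin S) (Fin S) ℂ)) (crossPart i G) i =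
      antennaLIF (fun _ : Fin K => (1 : Matrix (Fin S) (Fin S) ℂ)) G i := by
  ext j l
  refine Finset.sum_congr rfl fun k hk => ?_
  have h : crossPart i G k i j = G k i j := by
    ext m l
    rw [crossPart_apply, if_neg (Finset.ne_of_mem_erase hk)]
  rw [h]

lemma indepFun_crossPart {Ω : Type*} [MeasurableSpace Ω] {P : Measure Ω} {v : ℝ≥0}
    {G : Ω → Channels K S N L} (hG : IsGaussianChannel P v G) (i : Fin K) :
    IndepFun (fun ω => crossPart i (G ω)) (fun ω => G ω i) P := by
  let I : Finset (Fin K × Fin K × Fin N × Fin S × Fin L) := {q | q.1 ≠ i}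
  let J : Finset (Fin K × Fin K × Fin N × Fin S × Fin L) := {q | q.1 = i}
  have hIJ : Disjoint I J := by
    rw [Finset.disjoint_left]
    intro q hq hq'
    exact (Finset.mem_filter.1 hq).2 (Finset.mem_filter.1 hq').2
  have h := hG.indep.indepFun_finset I J hIJ fun _ => hG.measurable _ _ _ _ _
  let φ : (I → ℂ) → Channels K S N L := fun x k i' j m l =>
    if h : k = i then 0 else x ⟨(k, i', j, m, l), by simpa [I] using h⟩
  let ψ : (J → ℂ) → Fin K → Fin N → Matrix (Fin S) (Fin L) ℂ := fun x i' j m l =>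
    x ⟨(i, i', j, m, l), by simp [J]⟩
  have hφa : ∀ x k i' j m l, φ x k i' j m l =
      if h : k = i then 0 else x ⟨(k, i', j, m, l), by simpa [I] using h⟩ :=
    fun _ _ _ _ _ _ => rfl
  have hφ : Measurable φ := by
    refine measurable_channels fun k i' j m l => ?_
    by_cases hk : k = i
    · simp only [φ, hk, dite_true]; exact measurable_const
    · simp only [φ, hk, dite_false]; exact measurable_pi_apply _
  have hψ : Measurable ψ :=
    measurable_pi_lambda _ fun i' => measurable_pi_lambda _ fun j => measurable_pi_lambda _ fun m =>
      measurable_pi_lambda _ fun l => measurable_pi_apply _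
  have e : (fun ω => crossPart i (G ω)) =
      φ ∘ fun ω (q : I) => G ω q.1.1 q.1.2.1 q.1.2.2.1 q.1.2.2.2.1 q.1.2.2.2.2 := by
    ext ω k i' j m l
    refine (crossPart_apply i (G ω) k i' j m l).trans (Eq.trans ?_ (hφa (fun q =>
      G ω q.1.1 q.1.2.1 q.1.2.2.1 q.1.2.2.2.1 q.1.2.2.2.2) k i' j m l).symm)
    by_cases hk : k = i
    · rw [if_pos hk, dif_pos hk]
    · rw [if_neg hk, dif_neg hk]
  rw [e]
  exact h.comp hφ hψ

variable (A : Fin K → Fin N → AntennaRule L) (B : Fin K → UserRule N S)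

lemma measurable_antennaLIF_one (i : Fin K) (j : Fin N) :
    Measurable fun G : Channels K S N L =>
      antennaLIF (fun _ : Fin K => (1 : Matrix (Fin S) (Fin S) ℂ)) G i j := by
  refine measurable_pi_lambda _ fun l => ?_
  simp only [antennaLIF_one]
  exact Finset.measurable_sum _ fun k _ => Finset.measurable_sum _ fun s _ =>
    (measurable_channel_entry k i j s l).norm.pow_const 2

lemma measurable_selectedAntenna_one (i : Fin K) (j : Fin N) :
    Measurable fun G : Channels K S N L =>
      selectedAntenna A (fun _ : Fin K => (1 : Matrix (Fin S) (Fin S) ℂ)) G i j :=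
  (A i j).measurable_sel.comp (measurable_antennaLIF_one i j)

lemma measurable_metricAS_one (i : Fin K) :
    Measurable fun G : Channels K S N L =>
      metricAS A (fun _ : Fin K => (1 : Matrix (Fin S) (Fin S) ℂ)) G i := by
  refine measurable_pi_lambda _ fun j => ?_
  have h : Measurable fun p : (Fin L → ℝ) × Fin L => p.1 p.2 :=
    measurable_from_prod_countable_left fun l => measurable_pi_apply l
  exact h.comp ((measurable_antennaLIF_one i j).prodMk (measurable_selectedAntenna_one A i j))

/-- The users selected in cell `i`, with their antennas. -/
noncomputable def selection (i : Fin K) (G : Channels K S N L) : Fin S → Fin N × Fin L := fun s =>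
  (selectedUser A B (fun _ => 1) G i s,
    selectedAntenna A (fun _ : Fin K => (1 : Matrix (Fin S) (Fin S) ℂ)) G i
      (selectedUser A B (fun _ => 1) G i s))

lemma selection_crossPart (i : Fin K) (G : Channels K S N L) :
    selection A B i (crossPart i G) = selection A B i G := by
  have h : metricAS A (fun _ : Fin K => (1 : Matrix (Fin S) (Fin S) ℂ)) (crossPart i G) i =
      metricAS A (fun _ : Fin K => (1 : Matrix (Fin S) (Fin S) ℂ)) G i := by
    ext j
    simp only [metricAS, selectedAntenna, antennaLIF_crossPart]
  funext s
  simp only [selection, selectedUser, selectedAntenna, h, antennaLIF_crossPart]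

lemma measurable_selection (i : Fin K) : Measurable (selection A B i) := by
  refine measurable_pi_lambda _ fun s => ?_
  have hu : Measurable fun G : Channels K S N L => selectedUser A B (fun _ => 1) G i s :=
    (measurable_pi_apply s).comp ((B i).measurable_sel.comp (measurable_metricAS_one A i))
  have h : Measurable fun p : Channels K S N L × Fin N =>
      selectedAntenna A (fun _ : Fin K => (1 : Matrix (Fin S) (Fin S) ℂ)) p.1 i p.2 :=
    measurable_from_prod_countable_left fun j => measurable_selectedAntenna_one A i j
  exact hu.prodMk (h.comp (measurable_id.prodMk hu))

lemma effChannel_one (G : Channels K S N L) (k i : Fin K) (s r : Fin S) :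
    effChannel A B (fun _ => 1) G k i s r =
      G k i (selection A B i G s).1 r (selection A B i G s).2 := by
  rw [effChannel, Matrix.conjTranspose_one, Matrix.one_mulVec, weightAS,
    Matrix.mulVec_single_one]
  rfl

lemma map_directEntries {Ω : Type*} [MeasurableSpace Ω] {P : Measure Ω} {v : ℝ≥0}
    {G : Ω → Channels K S N L} (hG : IsGaussianChannel P v G) (i : Fin K)
    {σ : Fin S → Fin N × Fin L} (hσ : Function.Injective fun s => (σ s).1) :
    P.map (fun ω (p : Fin S × Fin S) => G ω i i (σ p.2).1 p.1 (σ p.2).2) =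
      Measure.pi fun _ => complexGaussian v := by
  have hinj : Function.Injective fun p : Fin S × Fin S =>
      (i, i, (σ p.2).1, p.1, (σ p.2).2) := by
    rintro ⟨a, b⟩ ⟨a', b'⟩ h
    simp only [Prod.mk.injEq] at h ⊢
    exact ⟨h.2.2.2.1, hσ h.2.2.1⟩
  have hi : iIndepFun (fun (p : Fin S × Fin S) ω => G ω i i (σ p.2).1 p.1 (σ p.2).2) P :=
    hG.indep.precomp hinj
  rw [hi.map_fun_eq_pi_map fun p => (hG.measurable _ _ _ _ _).aemeasurable]
  congr 1
  funext p
  exact hG.law _ _ _ _ _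

/-- Selection factors through `crossPart`, which shares no coefficient with the channels towards
base station `i`. Hence scheduling does not bias the direct channels. -/
lemma indepFun_selection {Ω : Type*} [MeasurableSpace Ω] {P : Measure Ω} {v : ℝ≥0}
    {G : Ω → Channels K S N L} (hG : IsGaussianChannel P v G) (i : Fin K)
    (σ : Fin S → Fin N × Fin L) :
    IndepFun (fun ω => selection A B i (G ω))
      (fun ω (p : Fin S × Fin S) => G ω i i (σ p.2).1 p.1 (σ p.2).2) P := by
  have hm : Measurable fun g : Fin K → Fin N → Matrix (Fin S) (Fin L) ℂ =>
      fun p : Fin S × Fin S => g i (σ p.2).1 p.1 (σ p.2).2 :=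
    measurable_pi_lambda _ fun p => (measurable_entry _ _).comp
      ((measurable_pi_apply _).comp (measurable_pi_apply i))
  have h := (indepFun_crossPart hG i).comp (measurable_selection A B i) hm
  have e : (selection A B i ∘ fun ω => crossPart i (G ω)) = fun ω => selection A B i (G ω) :=
    funext fun ω => selection_crossPart A B i (G ω)
  rw [e] at h
  exact h

/-- The direct channel of the selected users is dominated by the law of a white Gaussian matrix. -/
lemma measure_directChannel_mem_le {Ω : Type*} [MeasurableSpace Ω] {P : Measure Ω}
    [IsProbabilityMeasure P] {v : ℝ≥0} {G : Ω → Channels K S N L} (hG : IsGaussianChannel P v G)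
    (i : Fin K) {D : Set (Fin S × Fin S → ℂ)} (hD : MeasurableSet D) :
    P {ω | (fun p : Fin S × Fin S => effChannel A B (fun _ => 1) (G ω) i i p.2 p.1) ∈ D} ≤
      (Measure.pi fun _ => complexGaussian v) D := by
  have hsel : Measurable fun ω => selection A B i (G ω) :=
    (measurable_selection A B i).comp (measurable_channels hG.measurable)
  have hX : ∀ σ : Fin S → Fin N × Fin L,
      Measurable fun ω (p : Fin S × Fin S) => G ω i i (σ p.2).1 p.1 (σ p.2).2 := fun σ =>
    measurable_pi_lambda _ fun p => hG.measurable _ _ _ _ _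
  -- Split by the value `σ` of the selection: on each piece the direct matrix is a fixed submatrix,
  -- independent of the piece. Values with a repeated user never occur.
  have hterm : ∀ σ : Fin S → Fin N × Fin L, P ((fun ω => selection A B i (G ω)) ⁻¹' {σ} ∩
      (fun ω (p : Fin S × Fin S) => G ω i i (σ p.2).1 p.1 (σ p.2).2) ⁻¹' D) ≤
      P ((fun ω => selection A B i (G ω)) ⁻¹' {σ}) * (Measure.pi fun _ => complexGaussian v) D := by
    intro σ
    by_cases hσ : Function.Injective fun s => (σ s).1
    · rw [(indepFun_selection A B hG i σ).measure_inter_preimage_eq_mul _ _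
        (measurableSet_singleton σ) hD, ← map_directEntries hG i hσ, Measure.map_apply (hX σ) hD]
    · have : (fun ω => selection A B i (G ω)) ⁻¹' {σ} = ∅ := by
        refine Set.eq_empty_of_forall_notMem fun ω hω => hσ ?_
        rw [← Set.mem_singleton_iff.1 hω]
        exact (B i).injective_sel _
      rw [this, Set.empty_inter, measure_empty, zero_mul]
  have hcover : {ω | (fun p : Fin S × Fin S => effChannel A B (fun _ => 1) (G ω) i i p.2 p.1) ∈ D} ⊆
      ⋃ σ : Fin S → Fin N × Fin L, (fun ω => selection A B i (G ω)) ⁻¹' {σ} ∩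
        (fun ω (p : Fin S × Fin S) => G ω i i (σ p.2).1 p.1 (σ p.2).2) ⁻¹' D := by
    intro ω hω
    refine Set.mem_iUnion.2 ⟨selection A B i (G ω), rfl, ?_⟩
    have e : (fun p : Fin S × Fin S => effChannel A B (fun _ => 1) (G ω) i i p.2 p.1) =
        fun p => G ω i i (selection A B i (G ω) p.2).1 p.1 (selection A B i (G ω) p.2).2 :=
      funext fun p => effChannel_one A B (G ω) i i p.2 p.1
    rw [Set.mem_ofPred_eq, e] at hω
    exact hω
  refine (measure_mono hcover).trans ((measure_iUnion_fintype_le _ _).trans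
    ((Finset.sum_le_sum fun σ _ => hterm σ).trans ?_))
  rw [← Finset.sum_mul, sum_measure_preimage_singleton _ fun σ _ =>
    hsel (measurableSet_singleton σ)]
  exact mul_le_of_le_one_left' prob_le_one

/-- The square matrices whose zero-forcing equalizer has a large or undefined column. -/
def illConditioned (S : ℕ) (T : ℝ) : Set (Fin S × Fin S → ℂ) :=
  {x | (Matrix.of fun r s => x (r, s)).det = 0 ∨
    ∃ s, T < sqNorm (((Matrix.of fun r s => x (r, s))⁻¹)ᴴ.col s)}

lemma measurableSet_illConditioned (S : ℕ) (T : ℝ) : MeasurableSet (illConditioned S T) := by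
  have hc : Continuous fun x : Fin S × Fin S → ℂ => (Matrix.of fun r s => x (r, s)) :=
    continuous_matrix fun r s => continuous_apply (r, s)
  have hdet : Measurable fun x : Fin S × Fin S → ℂ => (Matrix.of fun r s => x (r, s)).det :=
    hc.matrix_det.measurable
  have hinv : ∀ r s, Measurable fun x : Fin S × Fin S → ℂ =>
      (Matrix.of fun r s => x (r, s))⁻¹ r s := by
    intro r s
    simp only [Matrix.inv_def, Ring.inverse_eq_inv', Matrix.smul_apply, smul_eq_mul]
    exact hdet.inv.mul (hc.matrix_adjugate.matrix_elem r s).measurable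
  refine MeasurableSet.union (hdet (measurableSet_singleton 0)) ?_
  have : {x : Fin S × Fin S → ℂ | ∃ s, T < sqNorm (((Matrix.of fun r s => x (r, s))⁻¹)ᴴ.col s)} =
      ⋃ s, {x | T < sqNorm (((Matrix.of fun r s => x (r, s))⁻¹)ᴴ.col s)} := by
    ext; simp
  change MeasurableSet {x : Fin S × Fin S → ℂ |
    ∃ s, T < sqNorm (((Matrix.of fun r s => x (r, s))⁻¹)ᴴ.col s)}
  rw [this]
  refine MeasurableSet.iUnion fun s => measurableSet_lt measurable_const ?_
  simp only [sqNorm, Matrix.col_apply, Matrix.conjTranspose_apply, norm_star]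
  exact Finset.measurable_sum _ fun r _ => (hinv s r).norm.pow_const 2

/-- The sets decrease, and their intersection lies in the null set of singular matrices. The
determinant clause matters: a singular matrix has inverse `0`, whose columns pass every nonnegative
norm bound. Neither `N`, `L` nor the SNR appears, so the cap can be fixed beforehand. -/
lemma tendsto_measure_illConditioned {v : ℝ≥0} (hv : v ≠ 0) (S : ℕ) :
    Tendsto (fun n : ℕ => (Measure.pi fun _ => complexGaussian v) (illConditioned S n))
      atTop (𝓝 0) := by
  have hanti : Antitone fun n : ℕ => illConditioned S n := by
    intro a b hab x hx
    refine hx.imp_right fun ⟨s, hs⟩ => ⟨s, lt_of_le_of_lt ?_ hs⟩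
    exact_mod_cast hab
  have h := tendsto_measure_iInter_atTop (s := fun n : ℕ => illConditioned S n) (μ := Measure.pi fun _ : Fin S × Fin S =>
    complexGaussian v) (fun n => (measurableSet_illConditioned S n).nullMeasurableSet) hanti
    ⟨0, measure_ne_top _ _⟩
  rwa [measure_mono_null (fun x hx => ?_)
    (pi_det_eq_zero (n := S) (complexGaussian_singleton hv))] at h
  by_contra hdet
  obtain ⟨n, hn⟩ := exists_nat_ge (∑ s, sqNorm (((Matrix.of fun r s => x (r, s))⁻¹)ᴴ.col s))
  obtain h0 | ⟨s, hs⟩ := Set.mem_iInter.1 hx n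
  · exact hdet h0
  · have hle : sqNorm (((Matrix.of fun r s => x (r, s))⁻¹)ᴴ.col s) ≤
        ∑ s, sqNorm (((Matrix.of fun r s => x (r, s))⁻¹)ᴴ.col s) :=
      Finset.single_le_sum (f := fun s => sqNorm (((Matrix.of fun r s => x (r, s))⁻¹)ᴴ.col s))
        (fun s _ => Finset.sum_nonneg fun _ _ => by positivity) (Finset.mem_univ s)
    linarith

end ZeroForcing

/-! ### Rate bound on the good event -/

section Deterministic

variable {K S N L : ℕ}

lemma sqNorm_nonneg {n : ℕ} (x : Fin n → ℂ) : 0 ≤ sqNorm x :=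
  Finset.sum_nonneg fun _ _ => by positivity

lemma norm_star_dotProduct_sq_le {n : ℕ} (x y : Fin n → ℂ) :
    ‖star x ⬝ᵥ y‖ ^ 2 ≤ sqNorm x * sqNorm y := by
  calc ‖star x ⬝ᵥ y‖ ^ 2 ≤ (∑ i, ‖x i‖ * ‖y i‖) ^ 2 := by
        gcongr
        refine (norm_sum_le _ _).trans (le_of_eq ?_)
        simp
    _ ≤ _ := Finset.sum_mul_sq_le_sq_mul_sq _ _ _

/-- Were a selected user above `t`, every user at most `t` would be among the other `S - 1` selected
ones. -/
lemma UserRule.apply_sel_le (R : UserRule N S) {x : Fin N → ℝ} {t : ℝ}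
    (h : S ≤ {j | x j ≤ t}.ncard) (s : Fin S) : x (R.sel x s) ≤ t := by
  by_contra! hcon
  have hsub : {j | x j ≤ t} ⊆ Set.range (R.sel x) \ {R.sel x s} := by
    intro j hj
    have hj' : x j ≤ t := hj
    refine ⟨?_, ?_⟩
    · by_contra hr
      exact absurd (R.sel_le x s j hr) (by linarith)
    · rintro rfl
      linarith
  have hlt := Set.ncard_le_ncard hsub (Set.toFinite _)
  have hd := Set.ncard_sdiff_singleton_lt_of_mem (Set.mem_range_self (f := R.sel x) s)
    (Set.toFinite _)
  have hr : (Set.range (R.sel x)).ncard = S := by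
    rw [← Set.image_univ, Set.ncard_image_of_injective _ (R.injective_sel x)]; simp
  omega

variable (A : Fin K → Fin N → AntennaRule L) (B : Fin K → UserRule N S)

lemma sqNorm_effChannel_le_metricAS (G : Channels K S N L) {k i : Fin K} (hki : k ≠ i)
    (s : Fin S) :
    sqNorm (effChannel A B (fun _ => 1) G k i s) ≤
      metricAS A (fun _ : Fin K => (1 : Matrix (Fin S) (Fin S) ℂ)) G i
        (selectedUser A B (fun _ => 1) G i s) := by
  rw [metricAS, antennaLIF_one]
  have h : sqNorm (effChannel A B (fun _ => 1) G k i s) =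
      ∑ r, ‖G k i (selection A B i G s).1 r (selection A B i G s).2‖ ^ 2 := by
    simp only [sqNorm, effChannel_one]
  rw [h]
  exact Finset.single_le_sum (f := fun k =>
    ∑ r, ‖G k i (selection A B i G s).1 r (selection A B i G s).2‖ ^ 2)
    (fun _ _ => Finset.sum_nonneg fun _ _ => by positivity)
    (Finset.mem_erase.2 ⟨hki, Finset.mem_univ k⟩)

/-- By Cauchy–Schwarz each interference term is at most `T t ρ`, and there are at most `K S` of
them; so interference and noise enhancement are each at most `T`, whence `2 * T`. -/
lemma mul_log_le_sumRate {G : Channels K S N L} {ρ t T : ℝ} (hρ : 0 < ρ) (hT : 0 < T)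
    (ht : 0 ≤ t) (htρ : K * S * t * ρ ≤ 1)
    (hmet : ∀ i, S ≤ {j | metricAS A (fun _ : Fin K => (1 : Matrix (Fin S) (Fin S) ℂ))
      G i j ≤ t}.ncard)
    (hzf : ∀ i, (fun p : Fin S × Fin S => effChannel A B (fun _ => 1) G i i p.2 p.1) ∉
      illConditioned S T) :
    K * S * Real.log (1 + ρ / (2 * T)) ≤ sumRate A B (fun _ => 1) G ρ := by
  have hrate : ∀ i s, Real.log (1 + ρ / (2 * T)) ≤ rate A B (fun _ => 1) G ρ i s := by
    intro i s
    have hz := hzf i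
    simp only [illConditioned, Set.mem_ofPred_eq, not_or, not_exists, not_lt] at hz
    obtain ⟨hdet, hle⟩ := hz
    set f := (zfEqualizer A B (fun _ => 1) G i).col s with hf
    have hfT : sqNorm f ≤ T := hle s
    -- A zero column would be a zero row of `Gm⁻¹`, against `Gm⁻¹ * Gm = 1`. Positivity is needed
    -- because division by zero would make the rate `log 1 = 0`.
    have hfpos : 0 < sqNorm f := by
      refine lt_of_le_of_ne (sqNorm_nonneg f) fun h0 => ?_
      have hzero : ∀ r, f r = 0 := by
        intro r
        have := (Finset.sum_eq_zero_iff_of_nonneg (fun _ _ => by positivity)).1 h0.symm r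
          (Finset.mem_univ r)
        simpa using this
      set Gm : Matrix (Fin S) (Fin S) ℂ :=
        Matrix.of fun r s => effChannel A B (fun _ => 1) G i i s r with hGm
      have hone : Gm⁻¹ * Gm = 1 := Matrix.nonsing_inv_mul _ (isUnit_iff_ne_zero.2 hdet)
      have hrow : ∀ r, Gm⁻¹ s r = 0 := by
        intro r
        have := hzero r
        simpa [hf, zfEqualizer] using this
      have := congrFun (congrFun hone s) s
      simp [Matrix.mul_apply, hrow] at this
    have hint : interference A B (fun _ => 1) G ρ i s ≤ T := by
      calc interference A B (fun _ => 1) G ρ i s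
          ≤ ∑ k ∈ Finset.univ.erase i, ∑ _m : Fin S, T * t * ρ := by
            refine Finset.sum_le_sum fun k hk => Finset.sum_le_sum fun m _ => ?_
            have h1 := norm_star_dotProduct_sq_le f (effChannel A B (fun _ => 1) G i k m)
            have h2 := (sqNorm_effChannel_le_metricAS A B G (Finset.ne_of_mem_erase hk).symm m).trans
              ((B k).apply_sel_le (hmet k) m)
            refine mul_le_mul_of_nonneg_right (h1.trans ?_) hρ.le
            exact mul_le_mul hfT h2 (sqNorm_nonneg _) hT.le
        _ ≤ ∑ _k : Fin K, ∑ _m : Fin S, T * t * ρ :=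
            Finset.sum_le_sum_of_subset_of_nonneg (Finset.subset_univ _) fun _ _ _ =>
              Finset.sum_nonneg fun _ _ => by positivity
        _ = T * (K * S * t * ρ) := by simp; ring
        _ ≤ T := mul_le_of_le_one_right hT.le htρ
    have hint0 : 0 ≤ interference A B (fun _ => 1) G ρ i s :=
      Finset.sum_nonneg fun _ _ => Finset.sum_nonneg fun _ _ => by positivity
    refine Real.log_le_log (by positivity) ?_
    gcongr
    linarith
  calc (K : ℝ) * S * Real.log (1 + ρ / (2 * T))
      = ∑ _i : Fin K, ∑ _s : Fin S, Real.log (1 + ρ / (2 * T)) := by simp [mul_assoc]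
    _ ≤ _ := Finset.sum_le_sum fun i _ => Finset.sum_le_sum fun s _ => hrate i s

end Deterministic

/-! ### Limits as the SNR grows -/

section Asymptotics

lemma eventually_le_mul_log_div_log {d T δ : ℝ} (hd : 0 ≤ d) (hT : 0 < T) (hδ : 0 < δ) :
    ∀ᶠ ρ : ℝ in atTop, d - δ ≤ d * Real.log (1 + ρ / (2 * T)) / Real.log ρ := by
  -- The threshold on `log ρ` is where `δ * log ρ` absorbs the constant loss `d * log (2 * T)`.
  filter_upwards [eventually_gt_atTop (1 : ℝ),
    Real.tendsto_log_atTop.eventually_ge_atTop (d * Real.log (2 * T) / δ)] with ρ hρ hlog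
  have hlogpos : 0 < Real.log ρ := Real.log_pos hρ
  rw [le_div_iff₀ hlogpos]
  have h1 : Real.log ρ - Real.log (2 * T) ≤ Real.log (1 + ρ / (2 * T)) := by
    rw [← Real.log_div (by positivity) (by positivity)]
    exact Real.log_le_log (by positivity) (by linarith)
  rw [div_le_iff₀ hδ] at hlog
  nlinarith [mul_le_mul_of_nonneg_left h1 hd]

/-- Subadditivity is used because the events are not assumed measurable. -/
lemma tendsto_measure_one_of_compl {Ω : ℝ → Type*} [∀ ρ, MeasurableSpace (Ω ρ)]
    {P : ∀ ρ, Measure (Ω ρ)} [∀ ρ, IsProbabilityMeasure (P ρ)] {E : ∀ ρ, Set (Ω ρ)}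
    (h : Tendsto (fun ρ => P ρ (E ρ)ᶜ) atTop (𝓝 0)) :
    Tendsto (fun ρ => P ρ (E ρ)) atTop (𝓝 1) := by
  have h1 : Tendsto (fun ρ => 1 - P ρ (E ρ)ᶜ) atTop (𝓝 1) := by
    simpa using ENNReal.Tendsto.sub tendsto_const_nhds h (Or.inl ENNReal.one_ne_top)
  refine tendsto_of_tendsto_of_tendsto_of_le_of_le h1 tendsto_const_nhds (fun ρ => ?_)
    fun ρ => prob_le_one
  rw [tsub_le_iff_right, ← measure_univ (μ := P ρ), ← Set.union_compl_self (E ρ)]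
  exact measure_union_le _ _

/-- A trial succeeds with probability at least `x = (c a / ρ) ^ n`, and `1 - x ≤ exp (-x)`. The
total exponent is at least a constant times `N L / ρ ^ n`, the inverse of the quantity that `hscale`
sends to zero. -/
lemma tendsto_scheduling_failure {v : ℝ≥0} (hv : v ≠ 0) {S n : ℕ} (hS : 1 ≤ S) (L N : ℝ → ℕ)
    (hL : ∀ ρ, 1 ≤ L ρ) (hN : ∀ ρ, S ≤ N ρ)
    (hscale : Tendsto (fun ρ : ℝ => ((L ρ : ℝ)⁻¹ * ρ ^ n) / (N ρ : ℝ)) atTop (𝓝 0))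
    {a : ℝ} (ha : 0 < a) :
    Tendsto (fun ρ : ℝ => (S : ℝ≥0∞) *
      (1 - complexGaussian v {z | ‖z‖ ^ 2 ≤ a * ρ⁻¹} ^ n) ^ (N ρ / S * L ρ)) atTop (𝓝 0) := by
  obtain ⟨c, hc, hball⟩ := exists_le_complexGaussian_ball hv
  have hinv : Tendsto (fun ρ : ℝ => (((L ρ : ℝ)⁻¹ * ρ ^ n) / (N ρ : ℝ))⁻¹) atTop atTop := by
    refine tendsto_inv_nhdsGT_zero.comp (tendsto_nhdsWithin_iff.2 ⟨hscale, ?_⟩)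
    filter_upwards [eventually_gt_atTop 0] with ρ hρ
    have h1 : (0 : ℝ) < L ρ := by exact_mod_cast hL ρ
    have h2 : (0 : ℝ) < N ρ := by exact_mod_cast hS.trans (hN ρ)
    exact Set.mem_Ioi.2 (by positivity)
  have hS0 : (0 : ℝ) < S := by exact_mod_cast hS
  set b : ℝ := (c * a) ^ n / (2 * S) with hb
  have hbpos : 0 < b := by positivity
  have hexp : Tendsto (fun ρ : ℝ => (S : ℝ≥0∞) * ENNReal.ofReal
      (Real.exp (-(b * (((L ρ : ℝ)⁻¹ * ρ ^ n) / (N ρ : ℝ))⁻¹)))) atTop (𝓝 0) := by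
    have h1 := Real.tendsto_exp_neg_atTop_nhds_zero.comp (hinv.const_mul_atTop hbpos)
    have h2 := ENNReal.Tendsto.const_mul (a := (S : ℝ≥0∞)) (ENNReal.tendsto_ofReal h1)
      (Or.inr (ENNReal.natCast_ne_top S))
    simpa [Function.comp_def] using h2
  refine tendsto_of_tendsto_of_tendsto_of_le_of_le' tendsto_const_nhds hexp
    (Eventually.of_forall fun _ => zero_le) ?_
  filter_upwards [eventually_gt_atTop 0, eventually_ge_atTop a] with ρ hρ hρa
  gcongr
  have hr0 : 0 ≤ a * ρ⁻¹ := by positivity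
  have hr1 : a * ρ⁻¹ ≤ 1 := by rw [← div_eq_mul_inv]; exact (div_le_one hρ).2 hρa
  set x : ℝ := (c * (a * ρ⁻¹)) ^ n with hx
  have hx0 : 0 ≤ x := by positivity
  have hq : 1 - complexGaussian v {z | ‖z‖ ^ 2 ≤ a * ρ⁻¹} ^ n ≤ ENNReal.ofReal (1 - x) := by
    rw [ENNReal.ofReal_sub _ hx0, ENNReal.ofReal_one, hx, ENNReal.ofReal_pow (by positivity)]
    gcongr
    exact hball _ hr0 hr1
  have hx1 : ENNReal.ofReal (1 - x) ≤ ENNReal.ofReal (Real.exp (-x)) :=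
    ENNReal.ofReal_le_ofReal (by linarith [Real.add_one_le_exp (-x)])
  calc _ ≤ ENNReal.ofReal (Real.exp (-x)) ^ (N ρ / S * L ρ) := by
        gcongr; exact hq.trans hx1
    _ = ENNReal.ofReal (Real.exp (-(((N ρ / S * L ρ : ℕ) : ℝ) * x))) := by
        rw [← ENNReal.ofReal_pow (Real.exp_pos _).le, ← Real.exp_nat_mul]
        congr 2; ring
    _ ≤ _ := by
        refine ENNReal.ofReal_le_ofReal (Real.exp_le_exp.2 (neg_le_neg ?_))
        have h2 : (0 : ℝ) < N ρ := by exact_mod_cast hS.trans (hN ρ)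
        -- Rounding down costs at most a factor `2` because `N ≥ S`; hence the `2 * S` in `b`.
        have hfloor : (N ρ : ℝ) / (2 * S) ≤ ((N ρ / S : ℕ) : ℝ) := by
          rw [div_le_iff₀ (by positivity)]
          have h3 : N ρ ≤ N ρ / S * (2 * S) := by
            have e1 := Nat.div_add_mod (N ρ) S
            have e2 := Nat.mod_lt (N ρ) hS
            have e3 : 1 ≤ N ρ / S := Nat.div_pos (hN ρ) hS
            nlinarith
          exact_mod_cast h3
        calc b * (((L ρ : ℝ)⁻¹ * ρ ^ n) / (N ρ : ℝ))⁻¹ = (N ρ : ℝ) / (2 * S) * L ρ * x := by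
              rw [hb, hx, mul_pow, mul_pow, mul_pow, inv_pow]
              field_simp
          _ ≤ ((N ρ / S : ℕ) : ℝ) * L ρ * x := by gcongr
          _ = _ := by push_cast; ring

end Asymptotics

/-! ### The two claims for white channels -/

section WhiteChannel

variable {K S : ℕ} {v : ℝ≥0} {L N : ℝ → ℕ} {Ω : ℝ → Type*} [∀ ρ, MeasurableSpace (Ω ρ)]
  {P : ∀ ρ, Measure (Ω ρ)} {G : ∀ ρ, Ω ρ → Channels K S (N ρ) (L ρ)}

lemma tendsto_measure_not_enough_users (hK : 1 ≤ K) (hS : 1 ≤ S) (hL : ∀ ρ, 1 ≤ L ρ)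
    (hN : ∀ ρ, S ≤ N ρ)
    (hscale : Tendsto
      (fun ρ : ℝ => ((L ρ : ℝ)⁻¹ * ρ ^ ((K - 1) * S)) / (N ρ : ℝ)) atTop (𝓝 0))
    (hv : v ≠ 0) (hG : ∀ ρ, IsGaussianChannel (P ρ) v (G ρ))
    (A : ∀ ρ, Fin K → Fin (N ρ) → AntennaRule (L ρ)) {ε : ℝ} (hε : 0 < ε) :
    Tendsto (fun ρ => P ρ {ω | ∀ i : Fin K, S ≤ {j : Fin (N ρ) |
      metricAS (A ρ) (fun _ : Fin K => (1 : Matrix (Fin S) (Fin S) ℂ)) (G ρ ω) i j ≤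
        ε * ρ⁻¹ / ((K : ℝ) * (S : ℝ) ^ 2)}.ncard}ᶜ) atTop (𝓝 0) := by
  have hK0 : (0 : ℝ) < K := by exact_mod_cast hK
  have hS0 : (0 : ℝ) < S := by exact_mod_cast hS
  -- The leakage budget is shared equally among `K S` coefficients.
  set a : ℝ := ε / (K * S ^ 2) / (K * S) with ha
  have h := ENNReal.Tendsto.const_mul (a := (K : ℝ≥0∞))
    (tendsto_scheduling_failure hv hS L N hL hN hscale (a := a) (by positivity))
    (Or.inr (ENNReal.natCast_ne_top K))
  rw [mul_zero] at h
  refine tendsto_of_tendsto_of_tendsto_of_le_of_le' tendsto_const_nhds h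
    (Eventually.of_forall fun _ => zero_le) ?_
  filter_upwards [eventually_gt_atTop 0] with ρ hρ
  have ht : K * S * (a * ρ⁻¹) ≤ ε * ρ⁻¹ / ((K : ℝ) * (S : ℝ) ^ 2) := by
    rw [ha]
    refine le_of_eq ?_
    field_simp
  calc _ ≤ P ρ (⋃ i : Fin K, {ω | ¬ S ≤ {j : Fin (N ρ) |
        metricAS (A ρ) (fun _ : Fin K => (1 : Matrix (Fin S) (Fin S) ℂ)) (G ρ ω) i j ≤
          ε * ρ⁻¹ / ((K : ℝ) * (S : ℝ) ^ 2)}.ncard}) := by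
        refine measure_mono fun ω hω => ?_
        simpa only [Set.mem_compl_iff, Set.mem_ofPred_eq, not_forall, Set.mem_iUnion] using hω
    _ ≤ _ := measure_iUnion_fintype_le _ _
    _ ≤ _ := Finset.sum_le_sum fun i _ =>
        measure_ncard_metricAS_lt (hG ρ) (A ρ) i (r := a * ρ⁻¹) (by positivity) ht
    _ = _ := by simp

lemma doFAtLeastWHP_white [∀ ρ, IsProbabilityMeasure (P ρ)] (hK : 1 ≤ K) (hS : 1 ≤ S)
    (hL : ∀ ρ, 1 ≤ L ρ) (hN : ∀ ρ, S ≤ N ρ)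
    (hscale : Tendsto
      (fun ρ : ℝ => ((L ρ : ℝ)⁻¹ * ρ ^ ((K - 1) * S)) / (N ρ : ℝ)) atTop (𝓝 0))
    (hv : v ≠ 0) (hG : ∀ ρ, IsGaussianChannel (P ρ) v (G ρ))
    (A : ∀ ρ, Fin K → Fin (N ρ) → AntennaRule (L ρ)) (B : ∀ ρ, Fin K → UserRule (N ρ) S) :
    DoFAtLeastWHP P (fun ρ ω => sumRate (A ρ) (B ρ) (fun _ => 1) (G ρ ω) ρ) ((K : ℝ) * S) := by
  have hS1 : (1 : ℝ) ≤ S := by exact_mod_cast hS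
  have hK0 : (0 : ℝ) < K := by exact_mod_cast hK
  intro δ hδ
  refine tendsto_measure_one_of_compl (ENNReal.tendsto_nhds_zero.2 fun η hη => ?_)
  have hη2 : 0 < η / 2 := ENNReal.div_pos hη.ne' ENNReal.ofNat_ne_top
  have hill := ENNReal.Tendsto.const_mul (a := (K : ℝ≥0∞)) (tendsto_measure_illConditioned hv S)
    (Or.inr (ENNReal.natCast_ne_top K))
  rw [mul_zero] at hill
  -- The cap `n` on the equalizer norms is chosen from `η` alone, before `ρ` is taken large.
  obtain ⟨n, hn, hn1⟩ :=
    ((ENNReal.tendsto_nhds_zero.1 hill _ hη2).and (eventually_ge_atTop 1)).exists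
  have hT : (0 : ℝ) < n := by exact_mod_cast hn1
  filter_upwards [ENNReal.tendsto_nhds_zero.1 (tendsto_measure_not_enough_users hK hS hL hN hscale
      hv hG A one_pos) _ hη2, eventually_gt_atTop (1 : ℝ),
    eventually_le_mul_log_div_log (d := (K : ℝ) * S) (by positivity) hT hδ] with ρ hmet hρ hlog
  have hρ0 : 0 < ρ := by linarith
  set E : Set (Ω ρ) := {ω | ∀ i : Fin K, S ≤ {j : Fin (N ρ) |
      metricAS (A ρ) (fun _ : Fin K => (1 : Matrix (Fin S) (Fin S) ℂ)) (G ρ ω) i j ≤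
        1 * ρ⁻¹ / ((K : ℝ) * (S : ℝ) ^ 2)}.ncard} with hE
  let F : Fin K → Set (Ω ρ) := fun i => {ω | (fun p : Fin S × Fin S =>
    effChannel (A ρ) (B ρ) (fun _ => 1) (G ρ ω) i i p.2 p.1) ∈ illConditioned S n}
  have hsub : {ω | (K : ℝ) * S - δ ≤
      sumRate (A ρ) (B ρ) (fun _ => 1) (G ρ ω) ρ / Real.log ρ}ᶜ ⊆ Eᶜ ∪ ⋃ i, F i := by
    intro ω hω
    by_contra hcon
    rw [Set.mem_union, not_or, Set.mem_compl_iff, not_not, Set.mem_iUnion, not_exists] at hcon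
    refine hω (hlog.trans ?_)
    refine div_le_div_of_nonneg_right ?_ (Real.log_pos hρ).le
    refine mul_log_le_sumRate (A ρ) (B ρ) hρ0 hT (by positivity) ?_ hcon.1 hcon.2
    -- The scheduling threshold with `ε = 1` already meets the interference budget.
    calc (K : ℝ) * S * (1 * ρ⁻¹ / (K * S ^ 2)) * ρ = (S : ℝ)⁻¹ := by
          field_simp
      _ ≤ 1 := inv_le_one_of_one_le₀ hS1
  calc _ ≤ P ρ Eᶜ + P ρ (⋃ i, F i) := (measure_mono hsub).trans (measure_union_le _ _)
    _ ≤ η / 2 + ∑ i, P ρ (F i) := add_le_add hmet (measure_iUnion_fintype_le _ _)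
    _ ≤ η / 2 + ∑ _i : Fin K, (Measure.pi fun _ => complexGaussian v) (illConditioned S n) := by
        gcongr with i
        exact measure_directChannel_mem_le (A ρ) (B ρ) (hG ρ) i (measurableSet_illConditioned S n)
    _ ≤ η / 2 + η / 2 := by
        gcongr
        simpa using hn
    _ = η := ENNReal.add_halves η

end WhiteChannel

end OIA

theorem theorem1 {K M S : ℕ} (hK : 1 ≤ K) (hS : 1 ≤ S) (hSM : S ≤ M)
    -- numbers of antennas and of users per cell, as functions of the SNR
    (L N : ℝ → ℕ) (hL : ∀ ρ, 1 ≤ L ρ) (hN : ∀ ρ, S ≤ N ρ)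
    (hscale : Tendsto
      (fun ρ : ℝ => ((L ρ : ℝ)⁻¹ * ρ ^ ((K - 1) * S)) / (N ρ : ℝ)) atTop (𝓝 0))
    {v : ℝ≥0} (hv : v ≠ 0)
    -- the random channels and reference bases at each SNR
    {Ω : ℝ → Type*} [∀ ρ, MeasurableSpace (Ω ρ)]
    (P : ∀ ρ, Measure (Ω ρ)) [∀ ρ, IsProbabilityMeasure (P ρ)]
    (H : ∀ ρ, Ω ρ → OIA.Channels K M (N ρ) (L ρ))
    (hH : ∀ ρ, OIA.IsGaussianChannel (P ρ) v (H ρ))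
    (Q : ∀ ρ, Ω ρ → Fin K → Matrix (Fin M) (Fin (M - S)) ℂ)
    (U : ∀ ρ, Ω ρ → Fin K → Matrix (Fin M) (Fin S) ℂ)
    (hQm : ∀ ρ, Measurable (Q ρ)) (hUm : ∀ ρ, Measurable (U ρ))
    (hQU : ∀ ρ, ∀ᵐ ω ∂(P ρ), ∀ k, OIA.IsReferenceBasis (Q ρ ω k) (U ρ ω k))
    (hindep : ∀ ρ, IndepFun (fun ω => (Q ρ ω, U ρ ω)) (H ρ) (P ρ))
    -- tie-breaking conventions of the selections
    (A : ∀ ρ, Fin K → Fin (N ρ) → OIA.AntennaRule (L ρ))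
    (B : ∀ ρ, Fin K → OIA.UserRule (N ρ) S) :
    OIA.DoFAtLeastWHP P
        (fun ρ ω => OIA.sumRate (A ρ) (B ρ) (U ρ ω) (H ρ ω) ρ) ((K : ℝ) * S) ∧
      ∀ ε : ℝ, 0 < ε →
        Tendsto (fun ρ => P ρ {ω | ∀ i : Fin K,
          S ≤ {j : Fin (N ρ) |
            OIA.metricAS (A ρ) (U ρ ω) (H ρ ω) i j ≤ ε * ρ⁻¹ / ((K : ℝ) * (S : ℝ) ^ 2)}.ncard})
          atTop (𝓝 1) := by
  
  have hG : ∀ ρ, OIA.IsGaussianChannel (P ρ) v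
      fun ω => OIA.projectedChannel (U ρ ω) (H ρ ω) := fun ρ =>
    (hH ρ).projectedChannel (hUm ρ)
      ((hQU ρ).mono fun ω h k => (h k).orthonormal)
      ((hindep ρ).comp measurable_snd measurable_id)
  constructor
  · simpa only [OIA.sumRate_projectedChannel] using
      OIA.doFAtLeastWHP_white hK hS hL hN hscale hv hG A B
  · intro ε hε
    refine OIA.tendsto_measure_one_of_compl ?_
    simpa only [OIA.metricAS_projectedChannel] using
      OIA.tendsto_measure_not_enough_users hK hS hL hN hscale hv hG A hε
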